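/- Setting. A finite MDP is $M=(\mathcal S,\mathcal A,P,R,\gamma,\eta_1)$ with non-empty finite state and action spaces, transition function $P:\mathcal S\times\mathcal A\to\Delta(\mathcal S)$, reward function $R:\mathcal S\times\mathcal A\to[0,1]$, discount factor $\gamma\in[0,1)$ and initial distribution $\eta_1$. For a stochastic policy $\pi$, $v^\pi$ is the expected discounted return from $\eta_1$, $v^\star=\sup_\pi v^\pi$, $Q^\star_M$ is the optimal $Q$-function of $M$, and $(\mathcal T_M f)(s,a)=R(s,a)+\gamma\,\mathbb E_{s'\sim P(s,a)}[\max_{a'}f(s',a')]$. A policy is $\epsilon$-optimal if $v^\star-v^\pi\le\epsilon$. A batch algorithm receives $\epsilon,\delta$ and $n$ i.i.d. tuples $(s,a,r,s')$ with $(s,a)\sim\mu$, $r=R(s,a)$, $s'\sim P(s,a)$, where $\mu\in\Delta(\mathcal S\times\mathcal A)$ is the data distribution, and returns a (possibly randomized) policy. Its sample complexity on $M$ under $\mu$ at $(\epsilon,\delta)$ is the least $n$ for which the returned policy is $\epsilon$-optimal with probability at least $1-\delta$. The distribution $\mu$ has concentratability coefficient at most $C$ on $M$ if $\nu(s,a)\le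 C\mu(s,a)$ for all $(s,a)$ and every $\nu$ that is the distribution of $(s_h,a_h)$ for some time step $h$ and some (possibly non-stationary, stochastic) policy. Theorem. There is a sequence, indexed by $k\in\mathbb N$, of problems, each consisting of a non-empty family $\mathcal M_k$ of MDPs with the same $\mathcal S_k,\mathcal A_k,\gamma_k$ (and even the same transitions and initial distribution), together with finite classes $\mathcal F_k,\mathcal G_k\subset(\mathcal S_k\times\mathcal A_k\to[0,1/(1-\gamma_k)])$ such that $Q^\star_{M'}\in\mathcal F_k$ for all $M'\in\mathcal M_k$ and $\mathcal T_{M'}f\in\mathcal G_k$ for all $M'\in\mathcal M_k$ and $f\in\mathcal F_k$, with the following property. For all data distributions $\mu_k\in\Delta(\mathcal S_k\times\mathcal A_k)$ and all batch algorithms (which may depend on everything about the $k$-th problem, in particular on $\mathcal F_k$, $\mathcal G_k$ and $\mu_k$), there are $M_k\in\mathcal M_k$ such that (a) there is no polynomial $p$ such that for all $k$ and all $\epsilon,\delta\in(0,1)$ the sample complexity of the algorithm on $M_k$ under $\mu_k$ at $(\epsilon,\delta)$ is at most $p\big(|\mathcal A_k|,\tfrac1{1-\gamma_k},\ln|\mathcal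 F_k|,\ln|\mathcal G_k|,\tfrac1\epsilon,\tfrac1\delta\big)$; (b) there is no polynomial $p$ such that for all $k$ the concentratability coefficient of $\mu_k$ on $M_k$ is at most $p\big(|\mathcal A_k|,\tfrac1{1-\gamma_k},\ln|\mathcal F_k|,\ln|\mathcal G_k|\big)$. -/

import Mathlib

open MeasureTheory

namespace BatchRL

noncomputable section

/-- A finite MDP `(S, A, P, R, γ, η₁)`; rewards are normalized to `[0, 1]` (that is, `R_max = 1`).
The simplex `Δ(X)` is `stdSimplex ℝ X`. -/
structure MDP (S A : Type) [Fintype S] [Fintype A] where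
  P : S → A → stdSimplex ℝ S
  R : S → A → ℝ
  γ : ℝ
  init : stdSimplex ℝ S
  R_mem : ∀ s a, R s a ∈ Set.Icc (0 : ℝ) 1
  γ_mem : γ ∈ Set.Ico (0 : ℝ) 1

/-- Stationary stochastic policies. -/
abbrev Policy (S A : Type) [Fintype A] : Type := S → stdSimplex ℝ A

namespace MDP

variable {S A : Type} [Fintype S] [Fintype A]

/-- The distribution of the state after `h` steps, from the state distribution `d`, when the
(possibly non-stationary) policy `π` is followed. -/
def stateDist (M : MDP S A) (π : ℕ → Policy S A) (d : S → ℝ) : ℕ → S → ℝ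
  | 0 => d
  | h + 1 => fun s' => ∑ s, ∑ a, M.stateDist π d h s * π h s a * M.P s a s'

/-- The expected discounted return of the stationary policy `π` from the state distribution `d`. -/
def returnFrom (M : MDP S A) (d : S → ℝ) (π : Policy S A) : ℝ :=
  ∑' h : ℕ, M.γ ^ h * ∑ s, ∑ a, M.stateDist (fun _ => π) d h s * π s a * M.R s a

/-- `v^π`, the expected return from the initial distribution. -/
def value (M : MDP S A) (π : Policy S A) : ℝ := M.returnFrom M.init π

/-- `v^⋆`. -/
def optValue (M : MDP S A) : ℝ := ⨆ π : Policy S A, M.value π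

/-- `Q^π(s, a)`: take `a` in `s` and follow `π` afterwards. -/
def qValue (M : MDP S A) (π : Policy S A) (s : S) (a : A) : ℝ :=
  M.R s a + M.γ * M.returnFrom (M.P s a) π

/-- `Q^⋆(s, a)`. -/
def optQ (M : MDP S A) (s : S) (a : A) : ℝ := ⨆ π : Policy S A, M.qValue π s a

/-- The Bellman update operator `𝒯_M`. -/
def bellman (M : MDP S A) (f : S → A → ℝ) (s : S) (a : A) : ℝ :=
  M.R s a + M.γ * ∑ s', M.P s a s' * ⨆ a', f s' a'

/-- `ν` is the law of the state-action pair after some number of steps under some (possibly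
non-stationary and stochastic) policy. -/
def Admissible (M : MDP S A) (ν : S → A → ℝ) : Prop :=
  ∃ (h : ℕ) (π : ℕ → Policy S A), ∀ s a, ν s a = M.stateDist π M.init h s * π h s a

/-- `ν(s, a) / μ(s, a) ≤ C` for all admissible `ν` and all `(s, a)`. -/
def Concentratability (M : MDP S A) (μ : stdSimplex ℝ (S × A)) (C : ℝ) : Prop :=
  ∀ ν, M.Admissible ν → ∀ s a, ν s a ≤ C * μ (s, a)

/-- The probability that `n` independent draws `(s, a) ∼ μ`, `s' ∼ P(s, a)` produce `d`. -/
def drawProb (M : MDP S A) (μ : stdSimplex ℝ (S × A)) {n : ℕ} (d : Fin n → S × A × S) : ℝ :=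
  ∏ i, μ ((d i).1, (d i).2.1) * M.P (d i).1 (d i).2.1 (d i).2.2

/-- The dataset of tuples `(s, a, r, s')`, `r = R(s, a)`, shown to the learner. -/
def dataset (M : MDP S A) {n : ℕ} (d : Fin n → S × A × S) : Fin n → S × A × ℝ × S :=
  fun i => ((d i).1, (d i).2.1, M.R (d i).1 (d i).2.1, (d i).2.2)

/-- The probability, over the `n` samples and the internal randomness of the learner `alg`, that
the policy returned by `alg` is `ε`-optimal. -/
def successProb (M : MDP S A) (μ : stdSimplex ℝ (S × A)) {n : ℕ}
    (alg : (Fin n → S × A × ℝ × S) → ProbabilityMeasure (Policy S A)) (ε : ℝ) : ℝ :=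
  ∑ d : Fin n → S × A × S, M.drawProb μ d *
    (alg (M.dataset d) : Measure (Policy S A)).real {π | M.optValue - M.value π ≤ ε}

end MDP

/-- A batch learning problem: a family of MDPs with given states, actions and discount factor, and
two finite function classes. -/
structure Problem where
  S : Type
  A : Type
  [fintypeS : Fintype S]
  [fintypeA : Fintype A]
  [nonemptyS : Nonempty S]
  [nonemptyA : Nonempty A]
  γ : ℝ
  family : Set (MDP S A)
  F : Finset (S → A → ℝ)
  G : Finset (S → A → ℝ)

attribute [instance] Problem.fintypeS Problem.fintypeA Problem.nonemptyS Problem.nonemptyA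

namespace Problem

/-- All MDPs of the family have the discount factor of the problem, and they share transitions and
initial distribution, so that they differ only in their rewards. -/
def SharedDynamics (X : Problem) : Prop :=
  (∀ M ∈ X.family, M.γ = X.γ) ∧
    ∀ M ∈ X.family, ∀ M' ∈ X.family, M.P = M'.P ∧ M.init = M'.init

/-- The functions in both classes take values in `[0, V_max]`, `V_max = 1 / (1 - γ)`. -/
def BoundedClasses (X : Problem) : Prop :=
  (∀ f ∈ X.F, ∀ s a, f s a ∈ Set.Icc 0 (1 / (1 - X.γ))) ∧
    ∀ g ∈ X.G, ∀ s a, g s a ∈ Set.Icc 0 (1 / (1 - X.γ))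

/-- `F` contains `Q^⋆_M` for every `M` in the family. -/
def Realizable (X : Problem) : Prop := ∀ M ∈ X.family, M.optQ ∈ X.F

/-- `G` contains `𝒯_M f` for every `M` in the family and every `f ∈ F`. -/
def Complete (X : Problem) : Prop := ∀ M ∈ X.family, ∀ f ∈ X.F, M.bellman f ∈ X.G

/-- A batch algorithm for `X`: given the accuracy `ε`, the confidence parameter `δ` and a dataset of
any size `n`, it returns a (random) policy. It may use everything about `X`, in particular
`F` and `G`. -/
abbrev Algorithm (X : Problem) : Type :=
  (ε δ : ℝ) → (n : ℕ) → (Fin n → X.S × X.A × ℝ × X.S) → ProbabilityMeasure (Policy X.S X.A)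

end Problem

/-- Run on data from `μ k` and `M k`, the sample complexity of `alg k` is bounded by one polynomial
in `|A|, 1/(1-γ), ln|F|, ln|G|, 1/ε, 1/δ`, for all `k`, `ε` and `δ`: at some sample size `n` below
the bound, it returns an `ε`-optimal policy with probability at least `1 - δ`. -/
def PolySampleComplexity (X : ℕ → Problem) (μ : ∀ k, stdSimplex ℝ ((X k).S × (X k).A))
    (alg : ∀ k, (X k).Algorithm) (M : ∀ k, MDP (X k).S (X k).A) : Prop :=
  ∃ p : MvPolynomial (Fin 6) ℝ, ∀ k, ∀ ε ∈ Set.Ioo (0 : ℝ) 1, ∀ δ ∈ Set.Ioo (0 : ℝ) 1,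
    ∃ n : ℕ,
      (n : ℝ) ≤ MvPolynomial.eval ![(Fintype.card (X k).A : ℝ), 1 / (1 - (X k).γ),
        Real.log (X k).F.card, Real.log (X k).G.card, 1 / ε, 1 / δ] p ∧
      1 - δ ≤ (M k).successProb (μ k) (alg k ε δ n) ε

/-- The concentratability coefficient of `μ k` on `M k` is bounded by one polynomial in
`|A|, 1/(1-γ), ln|F|, ln|G|`, for all `k`. -/
def PolyConcentratability (X : ℕ → Problem) (μ : ∀ k, stdSimplex ℝ ((X k).S × (X k).A))
    (M : ∀ k, MDP (X k).S (X k).A) : Prop :=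
  ∃ p : MvPolynomial (Fin 4) ℝ, ∀ k, ∃ C : ℝ,
    C ≤ MvPolynomial.eval ![(Fintype.card (X k).A : ℝ), 1 / (1 - (X k).γ),
      Real.log (X k).F.card, Real.log (X k).G.card] p ∧
    (M k).Concentratability (μ k) C

end

end BatchRL

/-! The family hides a needle in a haystack: a deterministic binary tree of depth `H` in which a
single leaf pays reward `1`, one MDP for each of the `2 ^ H` leaves. Both classes can be taken as
small as the family allows, so their logarithms, like the effective horizon, are linear in `H`.

For (a), the samples have the same law for every needle, and `n` of them expose at most `n` leaves.
On the remaining needles the learner sees the reward-free tree and returns one fixed law on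
policies. A near-optimal policy must reach the needle with probability above one half, which
excludes all other needles. Hence the success probabilities, summed over needles, are at most `n +
1` (`sum_successProb_le`), and some needle defeats all small sample sizes at once
(`exists_needle_not_found`).

For (b), every leaf is reached surely by some policy, while `μ` has total mass `1` to share among `2
^ H` leaves (`concentratability_ge`). This works for every needle, so the needle from (a) serves
both claims. -/

namespace BatchRL

/-! ### General facts on finite MDPs -/

namespace MDP

variable {S A : Type} [Fintype S] [Fintype A] (M : MDP S A)

theorem stateDist_nonneg (π : ℕ → Policy S A) {d : S → ℝ} (hd : ∀ s, 0 ≤ d s) (h : ℕ) (s : S) :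
    0 ≤ M.stateDist π d h s := by
  induction h generalizing s with
  | zero => exact hd s
  | succ h ih =>
    exact Finset.sum_nonneg fun s' _ => Finset.sum_nonneg fun a _ =>
      mul_nonneg (mul_nonneg (ih s') ((π h s').2.1 a)) ((M.P s' a).2.1 s)

theorem sum_stateDist (π : ℕ → Policy S A) (d : S → ℝ) (h : ℕ) :
    ∑ s, M.stateDist π d h s = ∑ s, d s := by
  induction h with
  | zero => rfl
  | succ h ih =>
    simp only [stateDist]
    rw [Finset.sum_comm, ← ih]
    refine Finset.sum_congr rfl fun s _ => ?_
    rw [Finset.sum_comm]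
    have hP : ∀ a, ∑ s', M.P s a s' = 1 := fun a => (M.P s a).2.2
    have hπ : ∑ a, π h s a = 1 := (π h s).2.2
    simp only [← Finset.mul_sum, hP, mul_one, hπ]

/-- The expected reward in a single step. -/
theorem expected_reward_mem (π : ℕ → Policy S A) (d : stdSimplex ℝ S) (h : ℕ) :
    ∑ s, ∑ a, M.stateDist π d h s * π h s a * M.R s a ∈ Set.Icc (0 : ℝ) 1 := by
  have hnn : ∀ s a, 0 ≤ M.stateDist π d h s * π h s a := fun s a =>
    mul_nonneg (M.stateDist_nonneg π d.2.1 h s) ((π h s).2.1 a)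
  refine ⟨Finset.sum_nonneg fun s _ => Finset.sum_nonneg fun a _ =>
    mul_nonneg (hnn s a) (M.R_mem s a).1, ?_⟩
  have hd : ∑ s, d s = 1 := d.2.2
  rw [← hd, ← M.sum_stateDist π d h]
  refine Finset.sum_le_sum fun s _ => ?_
  have hπ : ∑ a, π h s a = 1 := (π h s).2.2
  calc _ ≤ ∑ a, M.stateDist π d h s * π h s a :=
        Finset.sum_le_sum fun a _ => mul_le_of_le_one_right (hnn s a) (M.R_mem s a).2
    _ = _ := by rw [← Finset.mul_sum, hπ, mul_one]

theorem returnFrom_mem (d : stdSimplex ℝ S) (π : Policy S A) :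
    M.returnFrom d π ∈ Set.Icc 0 (1 / (1 - M.γ)) := by
  have hγ := M.γ_mem
  have hr := M.expected_reward_mem (fun _ => π) d
  have hs := summable_geometric_of_lt_one hγ.1 hγ.2
  have h0 : ∀ h, 0 ≤ M.γ ^ h * ∑ s, ∑ a, M.stateDist (fun _ => π) d h s * π s a * M.R s a :=
    fun h => mul_nonneg (pow_nonneg hγ.1 h) (hr h).1
  have h1 : ∀ h, M.γ ^ h * ∑ s, ∑ a, M.stateDist (fun _ => π) d h s * π s a * M.R s a ≤ M.γ ^ h :=
    fun h => mul_le_of_le_one_right (pow_nonneg hγ.1 h) (hr h).2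
  refine ⟨tsum_nonneg h0, ?_⟩
  rw [one_div, ← tsum_geometric_of_lt_one hγ.1 hγ.2]
  exact Summable.tsum_le_tsum h1 (Summable.of_nonneg_of_le h0 h1 hs) hs

theorem backup_mem {R γ v : ℝ} (hR : R ∈ Set.Icc (0 : ℝ) 1) (hγ : γ ∈ Set.Ico (0 : ℝ) 1)
    (hv : v ∈ Set.Icc 0 (1 / (1 - γ))) : R + γ * v ∈ Set.Icc 0 (1 / (1 - γ)) := by
  have hpos : 0 < 1 - γ := sub_pos.2 hγ.2
  refine ⟨add_nonneg hR.1 (mul_nonneg hγ.1 hv.1), ?_⟩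
  calc R + γ * v ≤ 1 + γ * (1 / (1 - γ)) :=
        add_le_add hR.2 (mul_le_mul_of_nonneg_left hv.2 hγ.1)
    _ = 1 / (1 - γ) := by field_simp; ring

theorem qValue_mem (π : Policy S A) (s : S) (a : A) :
    M.qValue π s a ∈ Set.Icc 0 (1 / (1 - M.γ)) :=
  backup_mem (M.R_mem s a) M.γ_mem (M.returnFrom_mem _ _)

theorem iSup_mem_Icc {ι : Type*} [Nonempty ι] {f : ι → ℝ} {b : ℝ}
    (hf : ∀ i, f i ∈ Set.Icc 0 b) : ⨆ i, f i ∈ Set.Icc 0 b :=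
  ⟨Real.iSup_nonneg fun i => (hf i).1, ciSup_le fun i => (hf i).2⟩

theorem nonempty_policy {S A : Type} [Fintype A] [Nonempty A] : Nonempty (Policy S A) := by
  classical
  exact ⟨fun _ => ⟨Pi.single (Classical.arbitrary A) 1, single_mem_stdSimplex ℝ _⟩⟩

theorem optQ_mem [Nonempty A] (s : S) (a : A) : M.optQ s a ∈ Set.Icc 0 (1 / (1 - M.γ)) :=
  haveI := nonempty_policy (S := S) (A := A)
  iSup_mem_Icc fun π => M.qValue_mem π s a

theorem bellman_mem [Nonempty A] {f : S → A → ℝ}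
    (hf : ∀ s a, f s a ∈ Set.Icc 0 (1 / (1 - M.γ))) (s : S) (a : A) :
    M.bellman f s a ∈ Set.Icc 0 (1 / (1 - M.γ)) := by
  refine backup_mem (M.R_mem s a) M.γ_mem ?_
  have hP : ∑ s', M.P s a s' = 1 := (M.P s a).2.2
  have hm : ∀ s', ⨆ a', f s' a' ∈ Set.Icc 0 (1 / (1 - M.γ)) := fun s' => iSup_mem_Icc (hf s')
  refine ⟨Finset.sum_nonneg fun s' _ => mul_nonneg ((M.P s a).2.1 s') (hm s').1, ?_⟩
  calc _ ≤ ∑ s', M.P s a s' * (1 / (1 - M.γ)) :=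
        Finset.sum_le_sum fun s' _ => mul_le_mul_of_nonneg_left (hm s').2 ((M.P s a).2.1 s')
    _ = _ := by rw [← Finset.sum_mul, hP, one_mul]

theorem value_le_optValue (π : Policy S A) : M.value π ≤ M.optValue :=
  le_ciSup (f := M.value) ⟨_, Set.forall_mem_range.2 fun π => (M.returnFrom_mem M.init π).2⟩ π

theorem drawProb_nonneg (μ : stdSimplex ℝ (S × A)) {n : ℕ} (d : Fin n → S × A × S) :
    0 ≤ M.drawProb μ d :=
  Finset.prod_nonneg fun _ _ => mul_nonneg (μ.2.1 _) ((M.P _ _).2.1 _)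

theorem sum_drawProb (μ : stdSimplex ℝ (S × A)) (n : ℕ) :
    ∑ d : Fin n → S × A × S, M.drawProb μ d = 1 := by
  classical
  have h := Finset.prod_univ_sum (fun _ : Fin n => (Finset.univ : Finset (S × A × S)))
    (fun _ x => μ (x.1, x.2.1) * M.P x.1 x.2.1 x.2.2)
  rw [Fintype.piFinset_univ] at h
  have hP : ∀ s a, ∑ s', M.P s a s' = 1 := fun s a => (M.P s a).2.2
  have hμ : ∑ x, μ x = 1 := μ.2.2
  unfold drawProb
  rw [← h]
  refine Finset.prod_eq_one fun _ _ => ?_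
  rw [← hμ]
  simp only [Fintype.sum_prod_type, ← Finset.mul_sum, hP, mul_one]

/-- Needed to add up the measures of the disjoint events `likelyReach`. -/
theorem measurable_stateDist (d : S → ℝ) (h : ℕ) (s : S) :
    Measurable fun π : Policy S A => M.stateDist (fun _ => π) d h s := by
  induction h generalizing s with
  | zero => exact measurable_const
  | succ h ih =>
    refine Finset.measurable_sum _ fun s' _ => Finset.measurable_sum _ fun a _ => ?_
    refine ((ih s').mul ?_).mul measurable_const
    exact (measurable_pi_apply a).comp (measurable_subtype_coe.comp (measurable_pi_apply s'))

end MDP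

/-! ### Polynomial against exponential growth -/

/-- A real polynomial grows at most polynomially in a bound on its arguments. -/
theorem exists_abs_eval_le {σ : Type*} (p : MvPolynomial σ ℝ) :
    ∃ (C : ℝ) (d : ℕ), 0 ≤ C ∧ ∀ (B : ℝ) (x : σ → ℝ), 1 ≤ B → (∀ i, |x i| ≤ B) →
      |MvPolynomial.eval x p| ≤ C * B ^ d := by
  induction p using MvPolynomial.induction_on with
  | C a => exact ⟨|a|, 0, abs_nonneg a, fun B x _ _ => by simp⟩
  | add p q hp hq =>
    obtain ⟨C, d, hC, h⟩ := hp
    obtain ⟨C', d', hC', h'⟩ := hq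
    refine ⟨C + C', max d d', add_nonneg hC hC', fun B x hB hx => ?_⟩
    rw [map_add, add_mul]
    refine (abs_add_le _ _).trans (add_le_add ((h B x hB hx).trans ?_) ((h' B x hB hx).trans ?_))
    · exact mul_le_mul_of_nonneg_left (pow_le_pow_right₀ hB (le_max_left _ _)) hC
    · exact mul_le_mul_of_nonneg_left (pow_le_pow_right₀ hB (le_max_right _ _)) hC'
  | mul_X p i hp =>
    obtain ⟨C, d, hC, h⟩ := hp
    refine ⟨C, d + 1, hC, fun B x hB hx => ?_⟩
    rw [map_mul, MvPolynomial.eval_X, abs_mul, pow_succ, ← mul_assoc]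
    exact mul_le_mul (h B x hB hx) (hx i) (abs_nonneg _) (by positivity)

theorem exists_poly_lt_two_pow (C : ℝ) (d : ℕ) : ∃ k : ℕ, C * (8 * ((k : ℝ) + 1)) ^ d < 2 ^ k := by
  have h := (tendsto_pow_const_div_const_pow_of_one_lt d (one_lt_two (α := ℝ))).comp
    (Filter.tendsto_add_atTop_nat 1)
  -- The factor `2` absorbs the shift from `2 ^ (k + 1)` to `2 ^ k`.
  have h2 := h.const_mul (2 * (|C| * 8 ^ d))
  rw [mul_zero] at h2
  obtain ⟨k, hk⟩ := (h2.eventually_lt_const one_pos).exists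
  refine ⟨k, ?_⟩
  have h2k : (0 : ℝ) < 2 ^ k := by positivity
  simp only [Function.comp, Nat.cast_add, Nat.cast_one] at hk
  rw [← mul_div_assoc, div_lt_one (by positivity), pow_succ] at hk
  have := mul_le_mul_of_nonneg_right (le_abs_self C)
    (by positivity : (0 : ℝ) ≤ (8 * ((k : ℝ) + 1)) ^ d)
  rw [mul_pow] at this ⊢
  nlinarith

end BatchRL

namespace BatchRL

noncomputable section

/-- The point mass. -/
def dirac {X : Type} [Fintype X] (x : X) : stdSimplex ℝ X :=
  open Classical in ⟨Pi.single x 1, single_mem_stdSimplex ℝ x⟩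

theorem dirac_apply {X : Type} [Fintype X] [DecidableEq X] (x y : X) :
    dirac x y = if y = x then 1 else 0 := by
  change (dirac x).1 y = _
  simp only [dirac, Pi.single_apply]
  congr

theorem sum_comp_le_sum {X Y : Type} [Fintype X] [Fintype Y] {g : X → Y}
    (hg : Function.Injective g) {f : Y → ℝ} (hf : ∀ y, 0 ≤ f y) : ∑ x, f (g x) ≤ ∑ y, f y := by
  calc ∑ x, f (g x) = ∑ y ∈ Finset.univ.map ⟨g, hg⟩, f y := by
        rw [Finset.sum_map]; rfl
    _ ≤ ∑ y, f y :=
      Finset.sum_le_sum_of_subset_of_nonneg (Finset.subset_univ _) fun y _ _ => hf y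

/-! ### The tree and its dynamics -/

/-- States of the binary tree of depth `H`: a clock, and the word of actions chosen so far. Clock
value `H` marks the leaves, clock value `H + 1` the absorbing end of the episode. -/
abbrev TreeState (H : ℕ) : Type := Fin (H + 2) × (Fin H → Bool)

namespace TreeState

variable {H : ℕ}

def root : TreeState H := (0, fun _ => false)

/-- Record the action at the position of the clock, and advance the clock. -/
def step (s : TreeState H) (a : Bool) : TreeState H :=
  (⟨min (s.1 + 1) (H + 1), by omega⟩, fun i => if (i : ℕ) = s.1 then a else s.2 i)

def leaf (w : Fin H → Bool) : TreeState H := (⟨H, by omega⟩, w)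

theorem leaf_injective : Function.Injective (leaf (H := H)) := fun _ _ h => congrArg Prod.snd h

/-- The action at `s` that leads towards `leaf w`. -/
def pointer (w : Fin H → Bool) (s : TreeState H) : Bool :=
  if h : (s.1 : ℕ) < H then w ⟨s.1, h⟩ else false

/-- The state at time `h` on the way to `leaf w`. -/
def path (w : Fin H → Bool) (h : ℕ) : TreeState H :=
  (⟨min h (H + 1), by omega⟩, fun i => if (i : ℕ) < h then w i else false)

theorem path_zero (w : Fin H → Bool) : path w 0 = root := by
  ext <;> simp [path, root]

theorem path_depth (w : Fin H → Bool) : path w H = leaf w := by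
  ext <;> simp [path, leaf]

theorem step_path (w : Fin H → Bool) (h : ℕ) :
    step (path w h) (pointer w (path w h)) = path w (h + 1) := by
  refine Prod.ext (Fin.ext ?_) (funext fun i => ?_)
  · simp only [step, path]
    omega
  · have hi := i.2
    have hclock : ((path w h).1 : ℕ) = min h (H + 1) := rfl
    change (if (i : ℕ) = (path w h).1 then pointer w (path w h) else
      if (i : ℕ) < h then w i else false) = if (i : ℕ) < h + 1 then w i else false
    by_cases h1 : (i : ℕ) = (path w h).1
    · have h2 : ((path w h).1 : ℕ) < H := by omega
      have h3 : (i : ℕ) < h + 1 := by omega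
      rw [if_pos h1, if_pos h3, pointer, dif_pos h2]
      exact congrArg w (Fin.ext h1.symm)
    · rw [if_neg h1]
      have : ((i : ℕ) < h + 1) ↔ (i : ℕ) < h := by omega
      simp only [this]

end TreeState

open TreeState

/-- The discount factor with effective horizon `2 (H + 1)`. -/
def treeDiscount (H : ℕ) : ℝ := 1 - 1 / (2 * ((H : ℝ) + 1))

theorem treeDiscount_mem (H : ℕ) : treeDiscount H ∈ Set.Ico (0 : ℝ) 1 := by
  have h : (0 : ℝ) ≤ H := H.cast_nonneg
  refine ⟨sub_nonneg.2 ?_, sub_lt_self _ (by positivity)⟩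
  rw [div_le_one (by positivity)]
  linarith

/-- Bernoulli's inequality: the discounted reward at depth `H` stays bounded below independently of
`H`. -/
theorem half_le_treeDiscount_pow (H : ℕ) : 1 / 2 ≤ treeDiscount H ^ H := by
  have h : (0 : ℝ) ≤ H := H.cast_nonneg
  have hm := treeDiscount_mem H
  have hb := one_add_mul_le_pow (a := treeDiscount H - 1) (by linarith [hm.1]) H
  rw [add_sub_cancel] at hb
  refine le_trans ?_ hb
  have : (H : ℝ) * (1 / (2 * ((H : ℝ) + 1))) ≤ 1 / 2 := by
    rw [mul_one_div, div_le_div_iff₀ (by positivity) (by positivity)]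
    linarith
  have e : treeDiscount H - 1 = -(1 / (2 * ((H : ℝ) + 1))) := by unfold treeDiscount; ring
  rw [e]
  linarith

/-- The tree whose leaves in `W` carry reward `1`; all other rewards vanish. -/
def treeMDP {H : ℕ} (W : Set (Fin H → Bool)) : MDP (TreeState H) Bool where
  P s a := dirac (step s a)
  R s _ := open Classical in if ∃ w ∈ W, s = leaf w then 1 else 0
  γ := treeDiscount H
  init := dirac root
  R_mem s a := by
    split_ifs
    · exact ⟨zero_le_one, le_rfl⟩
    · exact ⟨le_rfl, zero_le_one⟩
  γ_mem := treeDiscount_mem H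

variable {H : ℕ}

/-- Rewards do not affect the dynamics; the reward-free tree `W = ∅` is the common reference for all
needles. -/
theorem treeMDP_stateDist_eq (W : Set (Fin H → Bool)) (π : ℕ → Policy (TreeState H) Bool)
    (d : TreeState H → ℝ) (h : ℕ) :
    (treeMDP W).stateDist π d h = (treeMDP (∅ : Set (Fin H → Bool))).stateDist π d h := by
  induction h with
  | zero => rfl
  | succ h ih => simp only [MDP.stateDist, ih]; rfl

theorem treeMDP_drawProb_eq (W : Set (Fin H → Bool)) (μ : stdSimplex ℝ (TreeState H × Bool)) {n : ℕ}
    (d : Fin n → TreeState H × Bool × TreeState H) :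
    (treeMDP W).drawProb μ d = (treeMDP (∅ : Set (Fin H → Bool))).drawProb μ d := rfl

/-- The clock tells the time. -/
theorem treeMDP_stateDist_eq_zero (W : Set (Fin H → Bool)) (π : ℕ → Policy (TreeState H) Bool)
    {h : ℕ} {s : TreeState H} (hs : (s.1 : ℕ) ≠ min h (H + 1)) :
    (treeMDP W).stateDist π (treeMDP W).init h s = 0 := by
  induction h generalizing s with
  | zero =>
    change dirac root s = 0
    rw [dirac_apply, if_neg]
    rintro rfl
    exact hs (by simp [root])
  | succ h ih =>
    refine Finset.sum_eq_zero fun s' _ => Finset.sum_eq_zero fun a _ => ?_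
    by_cases hs' : (s'.1 : ℕ) = min h (H + 1)
    · have : (treeMDP W).P s' a s = 0 := by
        change dirac (step s' a) s = 0
        rw [dirac_apply, if_neg]
        rintro rfl
        exact hs (by simp only [step]; omega)
      rw [this, mul_zero]
    · rw [ih hs', zero_mul, zero_mul]

/-- The probability that `π` reaches `leaf w`. -/
def reachProb (π : Policy (TreeState H) Bool) (w : Fin H → Bool) : ℝ :=
  (treeMDP (∅ : Set (Fin H → Bool))).stateDist (fun _ => π) (dirac root) H (leaf w)

theorem reachProb_nonneg (π : Policy (TreeState H) Bool) (w : Fin H → Bool) :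
    0 ≤ reachProb π w :=
  MDP.stateDist_nonneg _ _ (dirac root).2.1 _ _

theorem sum_reachProb_le_one (π : Policy (TreeState H) Bool) : ∑ w, reachProb π w ≤ 1 := by
  have h1 : ∑ s, (dirac root : stdSimplex ℝ (TreeState H)) s = 1 := (dirac root).2.2
  rw [← h1, ← (treeMDP (∅ : Set (Fin H → Bool))).sum_stateDist (fun _ => π) _ H]
  exact sum_comp_le_sum leaf_injective fun s => MDP.stateDist_nonneg _ _ (dirac root).2.1 _ s

theorem measurable_reachProb (w : Fin H → Bool) :
    Measurable fun π : Policy (TreeState H) Bool => reachProb π w :=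
  MDP.measurable_stateDist _ _ _ _

theorem value_needle (π : Policy (TreeState H) Bool) (w : Fin H → Bool) :
    (treeMDP {w}).value π = treeDiscount H ^ H * reachProb π w := by
  have hR : ∀ s a, (treeMDP {w}).R s a = if s = leaf w then 1 else 0 := fun s a => by
    simp [treeMDP]
  have hterm : ∀ h, ∑ s, ∑ a, (treeMDP {w}).stateDist (fun _ => π) (treeMDP {w}).init h s * π s a *
      (treeMDP {w}).R s a =
      (treeMDP {w}).stateDist (fun _ => π) (treeMDP {w}).init h (leaf w) := fun h => by
    have hπ : ∀ s, ∑ a, π s a = 1 := fun s => (π s).2.2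
    simp only [hR, ← Finset.sum_mul, ← Finset.mul_sum, hπ, mul_one]
    simp
  unfold MDP.value MDP.returnFrom
  simp only [hterm]
  -- The clock shows `H` only at time `H`, since it then moves on to `H + 1` and stays there: the
  -- reward is collected at most once.
  rw [tsum_eq_single H]
  · rw [treeMDP_stateDist_eq]; rfl
  · intro h hh
    rw [treeMDP_stateDist_eq_zero, mul_zero]
    simp only [leaf]
    omega

/-- Following `pointer w` is to follow `path w`. -/
theorem stateDist_pointer (W : Set (Fin H → Bool)) (w : Fin H → Bool) (h : ℕ) :
    (treeMDP W).stateDist (fun _ s => dirac (pointer w s)) (treeMDP W).init h =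
      dirac (path w h) := by
  classical
  induction h with
  | zero => rw [path_zero]; rfl
  | succ h ih =>
    funext s'
    have hP : ∀ s a, (treeMDP W).P s a = dirac (step s a) := fun _ _ => rfl
    simp only [MDP.stateDist, ih, hP, dirac_apply]
    rw [Finset.sum_eq_single (path w h) (by intro b _ hb; simp [hb]) (by simp),
      Finset.sum_eq_single (pointer w (path w h)) (by intro b _ hb; simp [hb]) (by simp), step_path]
    simp

theorem le_optValue_needle (w : Fin H → Bool) :
    treeDiscount H ^ H ≤ (treeMDP {w}).optValue := by
  classical
  refine le_trans (le_of_eq ?_) ((treeMDP {w}).value_le_optValue fun s => dirac (pointer w s))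
  have h := congrFun (stateDist_pointer (∅ : Set (Fin H → Bool)) w H) (leaf w)
  rw [path_depth, dirac_apply, if_pos rfl] at h
  rw [value_needle, reachProb, ← mul_one (treeDiscount H ^ H)]
  congr 1
  · rw [mul_one]
  · exact h.symm

/-! ### Concentratability is exponential -/

theorem concentratability_ge {W : Set (Fin H → Bool)} {μ : stdSimplex ℝ (TreeState H × Bool)}
    {C : ℝ} (h : (treeMDP W).Concentratability μ C) : (2 : ℝ) ^ H ≤ C := by
  classical
  have hleaf : ∀ w : Fin H → Bool, 1 ≤ C * μ (leaf w, pointer w (leaf w)) := fun w => by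
    have hw := h _ ⟨H, fun _ s => dirac (pointer w s), fun _ _ => rfl⟩ (leaf w)
      (pointer w (leaf w))
    rw [stateDist_pointer, path_depth, dirac_apply, dirac_apply, if_pos rfl, if_pos rfl,
      mul_one] at hw
    exact hw
  have hC : 0 ≤ C := by
    by_contra hC
    have hμ0 : ∀ x, 0 ≤ μ x := μ.2.1
    exact absurd ((hleaf fun _ => false).trans
      (mul_nonpos_of_nonpos_of_nonneg (not_le.1 hC).le (hμ0 _))) (by norm_num)
  have hμ : ∑ x, μ x = 1 := μ.2.2
  have hsum : ∑ w : Fin H → Bool, μ (leaf w, pointer w (leaf w)) ≤ 1 := by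
    rw [← hμ]
    exact sum_comp_le_sum (g := fun w : Fin H → Bool => (leaf w, pointer w (leaf w)))
      (fun _ _ h => leaf_injective (congrArg Prod.fst h)) μ.2.1
  have hcard := Finset.sum_le_sum fun w (_ : w ∈ (Finset.univ : Finset (Fin H → Bool))) => hleaf w
  rw [← Finset.mul_sum] at hcard
  simp only [Finset.sum_const, Finset.card_univ, Fintype.card_fun, Fintype.card_bool,
    Fintype.card_fin, nsmul_eq_mul, mul_one, Nat.cast_pow, Nat.cast_ofNat] at hcard
  exact hcard.trans (mul_le_of_le_one_right hC hsum)

/-! ### Sample complexity is exponential -/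

/-- The policies that reach `leaf w` with probability more than one half. -/
def likelyReach (w : Fin H → Bool) : Set (Policy (TreeState H) Bool) :=
  {π | 1 / 2 < reachProb π w}

theorem measurableSet_likelyReach (w : Fin H → Bool) : MeasurableSet (likelyReach w) :=
  measurableSet_lt measurable_const (measurable_reachProb w)

theorem disjoint_likelyReach {w w' : Fin H → Bool} (hw : w ≠ w') :
    Disjoint (likelyReach w) (likelyReach w') := by
  rw [Set.disjoint_left]
  intro π h h'
  have h2 := Finset.sum_le_sum_of_subset_of_nonneg (Finset.subset_univ {w, w'})
    fun v _ _ => reachProb_nonneg π v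
  rw [Finset.sum_pair hw] at h2
  have h3 := sum_reachProb_le_one π
  simp only [likelyReach, Set.mem_ofPred_eq] at h h'
  linarith

theorem sum_measure_likelyReach_le (ν : ProbabilityMeasure (Policy (TreeState H) Bool)) :
    ∑ w, (ν : Measure (Policy (TreeState H) Bool)).real (likelyReach w) ≤ 1 := by
  rw [← measureReal_biUnion_finset (fun w _ w' _ hw => disjoint_likelyReach hw)
    fun w _ => measurableSet_likelyReach w]
  exact measureReal_le_one

/-- Reaching the needle with probability at most `1 / 2` loses at least half of `treeDiscount H ^
H`, hence at least `1 / 4`. -/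
theorem nearOptimal_subset_likelyReach (w : Fin H → Bool) :
    {π | (treeMDP {w}).optValue - (treeMDP {w}).value π ≤ 1 / 8} ⊆ likelyReach w := by
  intro π hπ
  rw [Set.mem_ofPred_eq, value_needle] at hπ
  have h1 := le_optValue_needle w
  have h2 := half_le_treeDiscount_pow H
  by_contra h
  rw [likelyReach, Set.mem_ofPred_eq, not_lt] at h
  nlinarith

/-- Unless the data contain `leaf w`, they do not depend on whether `w` is the needle. -/
theorem dataset_needle {n : ℕ} {d : Fin n → TreeState H × Bool × TreeState H} {w : Fin H → Bool}
    (hw : ∀ i, (d i).1 ≠ leaf w) :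
    (treeMDP {w}).dataset d = (treeMDP (∅ : Set (Fin H → Bool))).dataset d := by
  funext i
  simp [MDP.dataset, treeMDP, hw i]

theorem sum_success_le {n : ℕ} (d : Fin n → TreeState H × Bool × TreeState H)
    (alg : (Fin n → TreeState H × Bool × ℝ × TreeState H) →
      ProbabilityMeasure (Policy (TreeState H) Bool)) :
    ∑ w : Fin H → Bool, (alg ((treeMDP {w}).dataset d) : Measure (Policy (TreeState H) Bool)).real
      {π | (treeMDP {w}).optValue - (treeMDP {w}).value π ≤ 1 / 8} ≤ n + 1 := by
  classical
  let ν := alg ((treeMDP (∅ : Set (Fin H → Bool))).dataset d)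
  have hterm : ∀ w : Fin H → Bool,
      (alg ((treeMDP {w}).dataset d) : Measure (Policy (TreeState H) Bool)).real
        {π | (treeMDP {w}).optValue - (treeMDP {w}).value π ≤ 1 / 8} ≤
      (∑ i, if (d i).1 = leaf w then (1 : ℝ) else 0) +
        (ν : Measure (Policy (TreeState H) Bool)).real (likelyReach w) := fun w => by
    have hnn : ∀ i ∈ Finset.univ, (0 : ℝ) ≤ if (d i).1 = leaf w then (1 : ℝ) else 0 :=
      fun i _ => by split_ifs <;> norm_num
    by_cases hw : ∀ i, (d i).1 ≠ leaf w
    · rw [dataset_needle hw]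
      exact (measureReal_mono (nearOptimal_subset_likelyReach w)).trans
        (le_add_of_nonneg_left (Finset.sum_nonneg hnn))
    · push Not at hw
      obtain ⟨i, hi⟩ := hw
      have h1 := Finset.single_le_sum hnn (Finset.mem_univ i)
      rw [if_pos hi] at h1
      exact measureReal_le_one.trans (h1.trans (le_add_of_nonneg_right measureReal_nonneg))
  refine (Finset.sum_le_sum fun w _ => hterm w).trans ?_
  rw [Finset.sum_add_distrib, Finset.sum_comm]
  refine add_le_add ?_ (sum_measure_likelyReach_le ν)
  -- Each sample lies at no more than one leaf.
  calc _ ≤ ∑ _i : Fin n, (1 : ℝ) := Finset.sum_le_sum fun i _ => by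
        rw [Finset.sum_boole, Nat.cast_le_one, Finset.card_le_one]
        intro w hw w' hw'
        exact leaf_injective ((Finset.mem_filter.1 hw).2.symm.trans (Finset.mem_filter.1 hw').2)
    _ = n := by simp

theorem sum_successProb_le (μ : stdSimplex ℝ (TreeState H × Bool)) {n : ℕ}
    (alg : (Fin n → TreeState H × Bool × ℝ × TreeState H) →
      ProbabilityMeasure (Policy (TreeState H) Bool)) :
    ∑ w : Fin H → Bool, (treeMDP {w}).successProb μ alg (1 / 8) ≤ n + 1 := by
  unfold MDP.successProb
  simp only [treeMDP_drawProb_eq]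
  rw [Finset.sum_comm]
  simp only [← Finset.mul_sum]
  calc _ ≤ ∑ d, (treeMDP (∅ : Set (Fin H → Bool))).drawProb μ d * ((n : ℝ) + 1) :=
        Finset.sum_le_sum fun d _ =>
          mul_le_mul_of_nonneg_left (sum_success_le d alg) (MDP.drawProb_nonneg _ _ _)
    _ = _ := by rw [← Finset.sum_mul, MDP.sum_drawProb, one_mul]

theorem successProb_nonneg {S A : Type} [Fintype S] [Fintype A] (M : MDP S A)
    (μ : stdSimplex ℝ (S × A)) {n : ℕ}
    (alg : (Fin n → S × A × ℝ × S) → ProbabilityMeasure (Policy S A)) (ε : ℝ) :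
    0 ≤ M.successProb μ alg ε :=
  Finset.sum_nonneg fun _ _ => mul_nonneg (M.drawProb_nonneg _ _) measureReal_nonneg

/-- Some needle is not found from `n` samples, for any `n < m`. -/
theorem exists_needle_not_found (μ : stdSimplex ℝ (TreeState H × Bool))
    (alg : (n : ℕ) → (Fin n → TreeState H × Bool × ℝ × TreeState H) →
      ProbabilityMeasure (Policy (TreeState H) Bool)) {m : ℕ} (hm : 2 * m ^ 2 < 2 ^ H) :
    ∃ w : Fin H → Bool, ∀ n < m, (treeMDP {w}).successProb μ (alg n) (1 / 8) < 1 / 2 := by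
  by_contra! hall
  -- The failing needle must not depend on `n`, so successes are summed over all `n < m`: the total
  -- is at most `m * m`, whereas `2 ^ H` needles would need `2 ^ H / 2`.
  have h1 : ∀ w : Fin H → Bool, 1 / 2 ≤
      ∑ n ∈ Finset.range m, (treeMDP {w}).successProb μ (alg n) (1 / 8) := fun w => by
    obtain ⟨n, hn, h⟩ := hall w
    exact h.trans (Finset.single_le_sum (f := fun n => (treeMDP {w}).successProb μ (alg n) (1 / 8))
      (fun n _ => successProb_nonneg _ _ _ _) (Finset.mem_range.2 hn))
  have h2 := Finset.sum_le_sum fun w (_ : w ∈ (Finset.univ : Finset (Fin H → Bool))) => h1 w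
  rw [Finset.sum_comm] at h2
  have h3 : ∑ n ∈ Finset.range m, ∑ w : Fin H → Bool,
      (treeMDP {w}).successProb μ (alg n) (1 / 8) ≤ ∑ _n ∈ Finset.range m, (m : ℝ) :=
    Finset.sum_le_sum fun n hn => (sum_successProb_le μ (alg n)).trans
      (by exact_mod_cast Finset.mem_range.1 hn)
  have h4 := h2.trans h3
  simp only [Finset.sum_const, Finset.card_univ, Fintype.card_fun, Fintype.card_bool,
    Fintype.card_fin, nsmul_eq_mul, Nat.cast_pow, Nat.cast_ofNat, Finset.card_range] at h4
  have h5 : (2 * m ^ 2 : ℝ) < 2 ^ H := by exact_mod_cast hm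
  nlinarith

/-! ### The learning problem and its parameters -/

open Classical in
/-- Find the rewarded leaf of the tree of depth `H`. -/
def treeProblem (H : ℕ) : Problem where
  S := TreeState H
  A := Bool
  γ := treeDiscount H
  family := Set.range fun w : Fin H → Bool => treeMDP {w}
  F := Finset.univ.image fun w : Fin H → Bool => (treeMDP {w}).optQ
  -- Completeness mixes the reward of one needle with the `Q`-function of another; indexing by pairs
  -- only doubles the bound on the logarithm.
  G := Finset.univ.image fun v : (Fin H → Bool) × (Fin H → Bool) =>
    (treeMDP {v.1}).bellman (treeMDP {v.2}).optQ

theorem treeProblem_valid (H : ℕ) :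
    (treeProblem H).γ ∈ Set.Ico (0 : ℝ) 1 ∧ (treeProblem H).family.Nonempty ∧
      (treeProblem H).SharedDynamics ∧ (treeProblem H).BoundedClasses ∧
      (treeProblem H).Realizable ∧ (treeProblem H).Complete := by
  refine ⟨treeDiscount_mem H, Set.range_nonempty _, ⟨?_, ?_⟩, ⟨?_, ?_⟩, ?_, ?_⟩
  · rintro _ ⟨w, rfl⟩
    rfl
  · rintro _ ⟨w, rfl⟩ _ ⟨w', rfl⟩
    exact ⟨rfl, rfl⟩
  · intro f hf
    obtain ⟨w, -, rfl⟩ := Finset.mem_image.1 hf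
    exact (treeMDP {w}).optQ_mem
  · intro g hg
    obtain ⟨v, -, rfl⟩ := Finset.mem_image.1 hg
    exact (treeMDP {v.1}).bellman_mem (treeMDP {v.2}).optQ_mem
  · rintro _ ⟨w, rfl⟩
    exact Finset.mem_image.2 ⟨w, Finset.mem_univ _, rfl⟩
  · rintro _ ⟨w, rfl⟩ f hf
    obtain ⟨w', -, rfl⟩ := Finset.mem_image.1 hf
    exact Finset.mem_image.2 ⟨(w, w'), Finset.mem_univ _, rfl⟩

theorem treeProblem_card_F_le (H : ℕ) : (treeProblem H).F.card ≤ 2 ^ H :=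
  Finset.card_image_le.trans (by simp)

theorem treeProblem_card_G_le (H : ℕ) : (treeProblem H).G.card ≤ 2 ^ (2 * H) :=
  Finset.card_image_le.trans (by simp [pow_mul', sq])

theorem abs_log_natCast_le {a b : ℕ} (h : a ≤ 2 ^ b) : |Real.log a| ≤ b := by
  rw [abs_of_nonneg (Real.log_natCast_nonneg a)]
  rcases Nat.eq_zero_or_pos a with rfl | ha
  · simp
  calc Real.log a ≤ Real.log ((2 : ℝ) ^ b) :=
        Real.log_le_log (by exact_mod_cast ha) (by exact_mod_cast h)
    _ = b * Real.log 2 := Real.log_pow _ _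
    _ ≤ b := mul_le_of_le_one_right b.cast_nonneg (by linarith [Real.log_two_lt_d9])

theorem abs_treeProblem_parameters_le (k : ℕ) (i : Fin 4) :
    |(![(Fintype.card (treeProblem (2 * k + 2)).A : ℝ), 1 / (1 - (treeProblem (2 * k + 2)).γ),
      Real.log (treeProblem (2 * k + 2)).F.card,
      Real.log (treeProblem (2 * k + 2)).G.card] : Fin 4 → ℝ) i| ≤ 8 * ((k : ℝ) + 1) := by
  have hk : (0 : ℝ) ≤ k := k.cast_nonneg
  fin_cases i
  · change |((Fintype.card Bool : ℕ) : ℝ)| ≤ _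
    rw [Fintype.card_bool, Nat.cast_ofNat, abs_two]
    linarith
  · change |1 / (1 - treeDiscount (2 * k + 2))| ≤ _
    have : 1 / (1 - treeDiscount (2 * k + 2)) = 4 * k + 6 := by
      unfold treeDiscount
      push_cast
      field_simp
      ring
    rw [this, abs_of_nonneg (by positivity)]
    linarith
  · refine (abs_log_natCast_le (treeProblem_card_F_le _)).trans ?_
    push_cast
    linarith
  · refine (abs_log_natCast_le (treeProblem_card_G_le _)).trans ?_
    push_cast
    linarith

end

end BatchRL

theorem theorem3 :
    ∃ X : ℕ → BatchRL.Problem,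
      (∀ k, (X k).γ ∈ Set.Ico (0 : ℝ) 1 ∧ (X k).family.Nonempty ∧ (X k).SharedDynamics ∧
        (X k).BoundedClasses ∧ (X k).Realizable ∧ (X k).Complete) ∧
      ∀ (μ : ∀ k, stdSimplex ℝ ((X k).S × (X k).A)) (alg : ∀ k, (X k).Algorithm),
        ∃ M : ∀ k, BatchRL.MDP (X k).S (X k).A,
          (∀ k, M k ∈ (X k).family) ∧
          ¬ BatchRL.PolySampleComplexity X μ alg M ∧
          ¬ BatchRL.PolyConcentratability X μ M := by
  -- Depth `2 * k + 2` makes `2 * (2 ^ k) ^ 2 < 2 ^ H`, so sample sizes below `2 ^ k` fail.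
  refine ⟨fun k => BatchRL.treeProblem (2 * k + 2), fun k => BatchRL.treeProblem_valid _, fun μ alg => ?_⟩
  have hneedle : ∀ k, ∃ w : Fin (2 * k + 2) → Bool, ∀ n < 2 ^ k,
      (BatchRL.treeMDP {w}).successProb (μ k) (alg k (1 / 8) (1 / 2) n) (1 / 8) < 1 / 2 := fun k =>
    BatchRL.exists_needle_not_found (H := 2 * k + 2) (μ k) (alg k (1 / 8) (1 / 2)) (by
      have : 0 < 2 ^ (2 * k) := by positivity
      rw [← pow_mul, mul_comm k 2, pow_add]
      omega)
  choose w hw using hneedle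
  refine ⟨fun k => BatchRL.treeMDP {w k}, fun k => ⟨w k, rfl⟩, ?_, ?_⟩
  · rintro ⟨p, hp⟩
    obtain ⟨C, d, -, hC⟩ := BatchRL.exists_abs_eval_le p
    obtain ⟨k, hk⟩ := BatchRL.exists_poly_lt_two_pow C d
    obtain ⟨n, hn, hsucc⟩ := hp k (1 / 8) (by norm_num) (1 / 2) (by norm_num)
    have hk0 : (0 : ℝ) ≤ k := k.cast_nonneg
    refine absurd (hw k n ?_) (not_lt.2 (le_trans (by norm_num) hsucc))
    -- `8 * (k + 1)` bounds all six arguments, including `1 / ε = 8` already at `k = 0`.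
    have hlt := (hn.trans ((le_abs_self _).trans (hC (8 * ((k : ℝ) + 1)) _ (by linarith)
      fun i => ?_))).trans_lt hk
    · exact_mod_cast hlt
    · have hpar := BatchRL.abs_treeProblem_parameters_le k
      fin_cases i
      · exact hpar 0
      · exact hpar 1
      · exact hpar 2
      · exact hpar 3
      · change |(1 : ℝ) / (1 / 8)| ≤ _
        rw [abs_of_nonneg (by norm_num)]
        linarith
      · change |(1 : ℝ) / (1 / 2)| ≤ _
        rw [abs_of_nonneg (by norm_num)]
        linarith
  · rintro ⟨p, hp⟩
    obtain ⟨C, d, -, hC⟩ := BatchRL.exists_abs_eval_le p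
    obtain ⟨k, hk⟩ := BatchRL.exists_poly_lt_two_pow C d
    obtain ⟨c, hc, hconc⟩ := hp k
    have hk0 : (0 : ℝ) ≤ k := k.cast_nonneg
    have hlt := (hc.trans ((le_abs_self _).trans (hC (8 * ((k : ℝ) + 1)) _ (by linarith)
      (BatchRL.abs_treeProblem_parameters_le k)))).trans_lt hk
    have hge := BatchRL.concentratability_ge (H := 2 * k + 2) hconc
    exact absurd (hge.trans_lt hlt) (not_lt.2 (pow_le_pow_right₀ one_le_two (by omega)))
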